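/- Let $(S,+)$ be a commutative semigroup. Let $\beta S$ be the set of ultrafilters on $S$ with the operation determined by $A\in p+q \iff \{a\in S:\{b\in S: a+b\in A\}\in q\}\in p$, and let $K(\beta S)$ be the union of all minimal left ideals of $\beta S$. Let $(C_n)_{n=1}^\infty$ be a sequence of central subsets of $S$ with a common witness, i.e. there is an idempotent $p=p+p\in K(\beta S)$ such that $C_n\in p$ for every $n$. Let $\mathcal P_f(\mathbb N)$ be the set of nonempty finite subsets of $\mathbb N$, and for $\alpha,\beta\in\mathcal P_f(\mathbb N)$ write $\alpha<\beta$ if $\max\alpha<\min\beta$. For $i\in\{1,\dots,k\}$ let $(v^{(i)}_\alpha)_{\alpha\in\mathcal P_f(\mathbb N)}$ be an IP system in $S$, i.e. $v^{(i)}_{\alpha\cup\beta}=v^{(i)}_\alpha+v^{(i)}_\beta$ whenever $\alpha\cap\beta=\emptyset$. Then there exist sequences $(a_n)_{n=1}^\infty$ in $S$ and $(\alpha_n)_{n=1}^\infty$ in $\mathcal P_f(\mathbb N)$ with $\alpha_n<\alpha_{n+1}$ for all $n$ such that for every $F\in\mathcal P_f(\mathbb N)$, with $m=\min F$, $$\sum_{t\in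 F}a_t\in C_m,$$ and whenever $s\in\mathbb N$, $\beta_1<\beta_2<\dots<\beta_s$ are in $\mathcal P_f(\mathbb N)$ with each $\beta_j\subseteq F$, and $i_1,\dots,i_s\in\{1,\dots,k\}$, then, writing $\gamma_j=\bigcup_{t\in\beta_j}\alpha_t$, $$\sum_{t\in F}a_t+\sum_{j=1}^s v^{(i_j)}_{\gamma_j}\in C_m .$$ -/

import Mathlib

namespace CentralIP

section Ultrafilters

/- The semigroup operation on the Stone-Cech compactification `βS = Ultrafilter S`:
`A ∈ p + q` if and only if `{a | {b | a + b ∈ A} ∈ q} ∈ p`. -/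
attribute [local instance] Ultrafilter.addSemigroup

variable {S : Type*} [AddSemigroup S]

/-- A (nonempty) left ideal of `βS`. -/
def IsLeftIdeal (L : Set (Ultrafilter S)) : Prop :=
  L.Nonempty ∧ ∀ q : Ultrafilter S, ∀ p ∈ L, q + p ∈ L

/-- A minimal left ideal of `βS`. -/
def IsMinimalLeftIdeal (L : Set (Ultrafilter S)) : Prop :=
  IsLeftIdeal L ∧ ∀ L' : Set (Ultrafilter S), IsLeftIdeal L' → L' ⊆ L → L' = L

variable (S) in
/-- `K(βS)`, the union of all minimal left ideals of `βS`. -/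
def minimalIdeal : Set (Ultrafilter S) :=
  {p | ∃ L : Set (Ultrafilter S), IsMinimalLeftIdeal L ∧ p ∈ L}

/-- An idempotent of `βS` that lies in `K(βS)`. A set `A ⊆ S` is central if and only if
it is a member of such an ultrafilter. -/
def IsMinimalIdempotent (p : Ultrafilter S) : Prop :=
  p + p = p ∧ p ∈ minimalIdeal S

end Ultrafilters

/-- `α < β` for finite sets of indices: every element of `α` is below every element of `β`
(for nonempty sets, `max α < min β`). -/
def Before (α β : Finset ℕ) : Prop := ∀ x ∈ α, ∀ y ∈ β, x < y

/-- An IP system in `S`, indexed by the nonempty finite sets of natural numbers: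
`v (α ∪ β) = v α + v β` for disjoint `α, β`. The value at `∅` is irrelevant. -/
def IsIPSystem {S : Type*} [AddCommSemigroup S] (v : Finset ℕ → S) : Prop :=
  ∀ α β : Finset ℕ, α.Nonempty → β.Nonempty → Disjoint α β → v (α ∪ β) = v α + v β

end CentralIP

namespace CentralIP

attribute [local instance] Ultrafilter.addSemigroup

/-! An IP system is determined by its singletons, so the added terms amount to choosing, for each `t
∈ F`, nothing or one of the `k` systems summed over `α t`. One stage (`exists_add_sum_mem`) handles
all choices at once: members of `p ∈ K(βS)` are syndetic-like (`exists_finite_translates`), and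
Hales–Jewett applied to the colouring by translates gives a line on which one translate works.
Idempotence of `p` then links the stages (`exists_seq_sum_mem`). -/

/-- The translates of a member of `p ∈ K(βS)` by finitely many elements are enough to meet `y + p`
for every `y` in `S` with a zero adjoined. -/
theorem exists_finite_translates {S : Type*} [AddSemigroup S] {p : Ultrafilter S}
    (hp : p ∈ minimalIdeal S) {D : Set S} (hD : D ∈ p) :
    ∃ X : Finset S, ∀ y : WithZero S, ∃ x ∈ X,
      ∀ᶠ z : S in (p : Filter S),
        (x : WithZero S) + y + (z : WithZero S) ∈ ((↑) : S → WithZero S) '' D := by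
  obtain ⟨L, ⟨⟨-, hL⟩, hmin⟩, hpL⟩ := hp
  -- Every `q ∈ L` generates `L`. For `p` this yields compactness; for arbitrary `q` it gives `p = r
  -- + q`, so some translate of `D` lies in `q`.
  have hprincipal : ∀ q ∈ L, Set.range (fun r : Ultrafilter S => r + q) = L := by
    intro q hq
    refine hmin _ ⟨⟨q + q, q, rfl⟩, ?_⟩ ?_
    · rintro s _ ⟨r, rfl⟩
      exact ⟨s + r, add_assoc _ _ _⟩
    · rintro _ ⟨r, rfl⟩
      exact hL r q hq
  have hcompact : IsCompact L := by
    rw [← hprincipal p hpL]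
    exact isCompact_range (Ultrafilter.continuous_add_left p)
  obtain ⟨X, hX⟩ := hcompact.elim_finite_subcover
    (fun x : S => {q : Ultrafilter S | {z | x + z ∈ D} ∈ q})
    (fun x => ultrafilter_isOpen_basic _) (by
      intro q hq
      have hpq : p ∈ Set.range (fun r : Ultrafilter S => r + q) := by rwa [hprincipal q hq]
      obtain ⟨r, rfl⟩ := hpq
      have h : ∀ᶠ x in (r : Filter S), ∀ᶠ z in (q : Filter S), x + z ∈ D :=
        (Ultrafilter.eventually_add r q (· ∈ D)).1 hD
      obtain ⟨x, hx⟩ := h.exists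
      exact Set.mem_iUnion.2 ⟨x, hx⟩)
  refine ⟨X, fun y => ?_⟩
  induction y with
  | zero =>
    obtain ⟨x, hx, h⟩ := Set.mem_iUnion₂.1 (hX hpL)
    refine ⟨x, hx, Filter.mem_of_superset h fun z hz => ⟨x + z, hz, ?_⟩⟩
    simp
  | coe y =>
    obtain ⟨x, hx, h⟩ := Set.mem_iUnion₂.1 (hX (hL (pure y) p hpL))
    have h' : ∀ᶠ z in (p : Filter S), x + (y + z) ∈ D :=
      (Ultrafilter.eventually_add (pure y) p (fun z => x + z ∈ D)).1 h
    refine ⟨x, hx, Filter.mem_of_superset h' fun z hz => ⟨x + (y + z), hz, ?_⟩⟩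
    simp [add_assoc]

/-- Members of `p ∈ K(βS)` contain a common translate of the sums of finitely many sequences over
some finite index set beyond any given bound. -/
theorem exists_add_sum_mem {S : Type*} [AddCommSemigroup S] {p : Ultrafilter S}
    (hp : p ∈ minimalIdeal S) {D : Set S} (hD : D ∈ p) {A : Type*} [Finite A]
    (u : A → ℕ → WithZero S) (N : ℕ) :
    ∃ (a : S) (α : Finset ℕ), α.Nonempty ∧ (∀ t ∈ α, N ≤ t) ∧
      ∀ i, (a : WithZero S) + ∑ t ∈ α, u i t ∈ ((↑) : S → WithZero S) '' D := by
  classical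
  obtain ⟨X, hX⟩ := exists_finite_translates hp hD
  choose c hcX hc using hX
  obtain ⟨ι, hι, hHJ⟩ := Combinatorics.Line.exists_mono_in_high_dimension A X
  let e : ι ↪ ℕ := (Fintype.equivFin ι).toEmbedding.trans
    (Fin.valEmbedding.trans (addLeftEmbedding N))
  -- A word is coloured by the translate that serves its sum.
  obtain ⟨l, ⟨x, hx⟩, hmono⟩ := hHJ fun w => ⟨c (∑ d, u (w d) (e d)), hcX _⟩
  let act : Finset ι := Finset.univ.filter fun d => l.idxFun d = none
  -- The fixed coordinates contribute `b`, the same for all points of the line; it can be `0`, for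
  -- instance if every coordinate is active.
  let b : WithZero S := ∑ d ∈ actᶜ, (l.idxFun d).elim 0 fun i => u i (e d)
  have hsum : ∀ i, ∑ d, u (l i d) (e d) = b + ∑ t ∈ act.map e, u i t := by
    intro i
    rw [← Finset.sum_add_sum_compl act, add_comm, Finset.sum_map]
    congr 1
    · refine Finset.sum_congr rfl fun d hd => ?_
      have hd' : l.idxFun d ≠ none := by simpa [act] using hd
      obtain ⟨i', hi'⟩ := Option.ne_none_iff_exists'.1 hd'
      simp [Combinatorics.Line.coe_apply, hi']
    · refine Finset.sum_congr rfl fun d hd => ?_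
      have hd' : l.idxFun d = none := by simpa [act] using hd
      simp [Combinatorics.Line.coe_apply, hd']
  have hlarge : ∀ᶠ z : S in (p : Filter S), ∀ i,
      (x : WithZero S) + (b + ∑ t ∈ act.map e, u i t) + (z : WithZero S) ∈
        ((↑) : S → WithZero S) '' D := by
    refine Filter.eventually_all.2 fun i => ?_
    have h := hc (∑ d, u (l i d) (e d))
    have hcx : c (∑ d, u (l i d) (e d)) = x := congrArg Subtype.val (hmono i)
    rwa [hcx, hsum i] at h
  obtain ⟨z, hz⟩ := hlarge.exists
  obtain ⟨a, ha⟩ : ∃ a : S, (a : WithZero S) = x + b + z := by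
    induction b with
    | zero => exact ⟨x + z, by simp⟩
    | coe b => exact ⟨x + b + z, by simp⟩
  refine ⟨a, act.map e, ?_, ?_, fun i => ?_⟩
  · obtain ⟨d, hd⟩ := l.proper
    exact ⟨e d, Finset.mem_map_of_mem e (by simp [act, hd])⟩
  · intro t ht
    obtain ⟨d, -, rfl⟩ := Finset.mem_map.1 ht
    exact Nat.le_add_right N _
  · rw [ha]
    convert hz i using 1
    abel

/-- One can choose finite index sets and translates successively, with sums over different stages
staying in the prescribed members of a minimal idempotent. -/
theorem exists_seq_sum_mem {S : Type*} [AddCommSemigroup S] {p : Ultrafilter S}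
    (hp : IsMinimalIdempotent p) {C : ℕ → Set S} (hC : ∀ n, C n ∈ p)
    {A : Type*} [Finite A] (u : A → ℕ → WithZero S) :
    ∃ (a : ℕ → S) (α : ℕ → Finset ℕ), (∀ n, (α n).Nonempty) ∧
      (∀ n, Before (α n) (α (n + 1))) ∧
      ∀ (f : ℕ → A) (F : Finset ℕ) (hF : F.Nonempty),
        ∑ t ∈ F, ((a t : WithZero S) + ∑ r ∈ α t, u (f t) r) ∈
          ((↑) : S → WithZero S) '' C (F.min' hF) := by
  classical
  -- Idempotence: `p`-almost every `x ∈ E` has its shift `{y | x + y ∈ E}` in `p`.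
  have hstar : ∀ E ∈ p, {x ∈ E | ∀ᶠ y in (p : Filter S), x + y ∈ E} ∈ p := by
    intro E hE
    refine Filter.inter_mem hE ?_
    have h : E ∈ p + p := by rwa [hp.1]
    exact (Ultrafilter.eventually_add p p (· ∈ E)).1 h
  have hstep : ∀ (E : {E : Set S // E ∈ p}) (N : ℕ), ∃ (a : S) (α : Finset ℕ) (x : A → S),
      α.Nonempty ∧ (∀ t ∈ α, N ≤ t) ∧ ∀ i, (a : WithZero S) + ∑ t ∈ α, u i t = x i ∧
        x i ∈ E.1 ∧ ∀ᶠ y in (p : Filter S), x i + y ∈ E.1 := by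
    intro E N
    obtain ⟨a, α, hα, hN, h⟩ := exists_add_sum_mem hp.2 (hstar E.1 E.2) u N
    choose x hx hx' using h
    exact ⟨a, α, x, hα, hN, fun i => ⟨(hx' i).symm, hx i⟩⟩
  choose a α x hα hN hx using hstep
  -- The state is a member of `p` that must contain all later sums, and a lower bound for later
  -- indices.
  let next : ℕ → {E : Set S // E ∈ p} × ℕ → {E : Set S // E ∈ p} × ℕ := fun n s =>
    (⟨(s.1.1 ∩ C (n + 1)) ∩ {y | ∀ i, x s.1 s.2 i + y ∈ s.1.1},
      Filter.inter_mem (Filter.inter_mem s.1.2 (hC (n + 1)))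
        (Filter.eventually_all.2 fun i => (hx s.1 s.2 i).2.2)⟩,
      (α s.1 s.2).sup id + 1)
  let s : ℕ → {E : Set S // E ∈ p} × ℕ := fun n => Nat.rec (⟨C 0, hC 0⟩, 0) next n
  have hs : ∀ n, s (n + 1) = next n (s n) := fun n => rfl
  have hanti : Antitone fun n => (s n).1.1 :=
    antitone_nat_of_succ_le fun n => by
      rw [hs]
      exact fun y hy => hy.1.1
  have hsC : ∀ n, (s n).1.1 ⊆ C n := by
    rintro (_ | n)
    · exact subset_rfl
    · rw [hs]
      exact fun y hy => hy.1.2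
  refine ⟨fun n => a (s n).1 (s n).2, fun n => α (s n).1 (s n).2, fun n => hα _ _, ?_, ?_⟩
  · intro n r hr t ht
    have h1 : r ≤ (α (s n).1 (s n).2).sup id := Finset.le_sup (f := id) hr
    have h2 := hN _ _ t ht
    rw [hs] at h2
    exact lt_of_lt_of_le (Nat.lt_succ_of_le h1) h2
  · intro f F hF
    suffices h : ∃ y ∈ (s (F.min' hF)).1.1, (y : WithZero S) =
        ∑ t ∈ F, ((a (s t).1 (s t).2 : WithZero S) + ∑ r ∈ α (s t).1 (s t).2, u (f t) r) by
      obtain ⟨y, hy, h⟩ := h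
      exact ⟨y, hsC _ hy, h⟩
    simp only [(hx _ _ _).1]
    -- Removing the minimum `m` leaves a sum in the set of stage `m + 1`, which the shift by any `x
    -- i` of stage `m` sends into the set of stage `m`.
    induction F using Finset.induction_on_min with
    | empty => exact absurd hF Finset.not_nonempty_empty
    | insert m F hm ih =>
      have hmin : (insert m F).min' hF = m :=
        (Finset.min'_eq_iff _ hF m).2 ⟨Finset.mem_insert_self _ _, fun t ht => by
          rcases Finset.mem_insert.1 ht with rfl | ht
          exacts [le_rfl, (hm t ht).le]⟩
      rw [hmin, Finset.sum_insert fun h => (hm m h).false]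
      rcases F.eq_empty_or_nonempty with rfl | hF'
      · exact ⟨_, (hx (s m).1 (s m).2 (f m)).2.1, by simp⟩
      · obtain ⟨y, hy, hy'⟩ := ih hF'
        have hle : m + 1 ≤ F.min' hF' := hm _ (F.min'_mem hF')
        have hmem : y ∈ (s (m + 1)).1.1 := hanti hle hy
        rw [hs] at hmem
        exact ⟨_, hmem.2 (f m), by rw [WithZero.coe_add, hy']⟩

theorem IsIPSystem.coe_eq_sum {S : Type*} [AddCommSemigroup S] {v : Finset ℕ → S}
    (hv : IsIPSystem v) {γ : Finset ℕ} (hγ : γ.Nonempty) :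
    (v γ : WithZero S) = ∑ t ∈ γ, (v {t} : WithZero S) := by
  induction hγ using Finset.Nonempty.cons_induction with
  | singleton t => simp
  | cons t γ ht hγ ih =>
    rw [Finset.sum_cons, ← ih, Finset.cons_eq_insert, Finset.insert_eq,
      hv _ _ (Finset.singleton_nonempty t) hγ (Finset.disjoint_singleton_left.2 ht),
      WithZero.coe_add]

theorem Before.disjoint {α β : Finset ℕ} (h : Before α β) : Disjoint α β :=
  Finset.disjoint_left.2 fun t ht ht' => (h t ht t ht').false

theorem before_of_lt {α : ℕ → Finset ℕ} (hne : ∀ n, (α n).Nonempty)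
    (hα : ∀ n, Before (α n) (α (n + 1))) {m n : ℕ} (hmn : m < n) : Before (α m) (α n) := by
  induction n, hmn using Nat.le_induction with
  | base => exact hα m
  | succ n _ ih =>
    intro r hr t ht
    obtain ⟨w, hw⟩ := hne n
    exact (ih r hr w hw).trans (hα n w hw t ht)

theorem pairwise_disjoint_of_before {α : ℕ → Finset ℕ} (hne : ∀ n, (α n).Nonempty)
    (hα : ∀ n, Before (α n) (α (n + 1))) : Pairwise (Function.onFun Disjoint α) := by
  intro m n hmn
  rcases hmn.lt_or_gt with h | h
  · exact (before_of_lt hne hα h).disjoint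
  · exact (before_of_lt hne hα h).disjoint.symm

/-- Summing different functions over disjoint subsets of `F` amounts to choosing for each element
of `F` at most one of the functions. -/
theorem exists_choice_sum_eq {M I J : Type*} [AddCommMonoid M] [Fintype J] (g : I → ℕ → M)
    (F : Finset ℕ) (β : J → Finset ℕ) (hβF : ∀ j, β j ⊆ F)
    (hβ : Pairwise (Function.onFun Disjoint β)) (i : J → I) :
    ∃ f : ℕ → Option I,
      ∑ j, ∑ t ∈ β j, g (i j) t = ∑ t ∈ F, (f t).elim 0 fun i => g i t := by
  classical
  refine ⟨fun t => if h : ∃ j, t ∈ β j then some (i h.choose) else none, ?_⟩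
  have hind : ∀ j, ∑ t ∈ β j, g (i j) t = ∑ t ∈ F, if t ∈ β j then g (i j) t else 0 := by
    intro j
    rw [← Finset.sum_filter, Finset.filter_mem_eq_inter, Finset.inter_eq_right.2 (hβF j)]
  simp only [hind]
  rw [Finset.sum_comm]
  refine Finset.sum_congr rfl fun t _ => ?_
  by_cases h : ∃ j, t ∈ β j
  · rw [dif_pos h, Finset.sum_eq_single h.choose]
    · simp [h.choose_spec]
    · intro j _ hj
      exact if_neg fun ht => Finset.disjoint_left.1 (hβ hj) ht h.choose_spec
    · simp
  · rw [dif_neg h]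
    exact Finset.sum_eq_zero fun j _ => if_neg fun ht => h ⟨j, ht⟩

end CentralIP

/-- `S` need not have a zero, so finite sums are computed in `WithZero S`, that is, `S` with a
new zero adjoined; the conclusion says that they are (the images of) elements of `C m`. -/
theorem theorem5p1 {S : Type*} [AddCommSemigroup S]
    (p : Ultrafilter S) (hp : CentralIP.IsMinimalIdempotent p)
    (C : ℕ → Set S) (hC : ∀ n, C n ∈ p)
    (k : ℕ) (v : Fin k → Finset ℕ → S) (hv : ∀ i, CentralIP.IsIPSystem (v i)) :
    ∃ (a : ℕ → S) (α : ℕ → Finset ℕ),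
      (∀ n, (α n).Nonempty) ∧
      (∀ n, CentralIP.Before (α n) (α (n + 1))) ∧
      ∀ (F : Finset ℕ) (hF : F.Nonempty),
        (∑ t ∈ F, (a t : WithZero S)) ∈ ((↑) : S → WithZero S) '' C (F.min' hF) ∧
        ∀ (s : ℕ) (β : Fin s → Finset ℕ) (i : Fin s → Fin k),
          (∀ j, (β j).Nonempty) →
          (∀ j, β j ⊆ F) →
          (∀ j j' : Fin s, j < j' → CentralIP.Before (β j) (β j')) →
          ((∑ t ∈ F, (a t : WithZero S)) + ∑ j, (v (i j) ((β j).biUnion α) : WithZero S)) ∈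
            ((↑) : S → WithZero S) '' C (F.min' hF) := by
  classical
  -- The letter `none` means adding nothing, so the plain sums of `a` are covered too.
  let u : Option (Fin k) → ℕ → WithZero S := fun o t => o.elim 0 fun i => (v i {t} : WithZero S)
  obtain ⟨a, α, hne, hα, h⟩ := CentralIP.exists_seq_sum_mem hp hC u
  refine ⟨a, α, hne, hα, fun F hF => ⟨?_, fun s β i hβne hβF hβ => ?_⟩⟩
  · simpa [u] using h (fun _ => none) F hF
  · have hdisj : Pairwise (Function.onFun Disjoint β) := by
      intro j j' hj
      rcases hj.lt_or_gt with h | h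
      · exact (hβ j j' h).disjoint
      · exact (hβ j' j h).disjoint.symm
    obtain ⟨f, hf⟩ := CentralIP.exists_choice_sum_eq
      (fun i t => ∑ r ∈ α t, (v i {r} : WithZero S)) F β hβF hdisj i
    have hv' : ∀ j, (v (i j) ((β j).biUnion α) : WithZero S) =
        ∑ t ∈ β j, ∑ r ∈ α t, (v (i j) {r} : WithZero S) := by
      intro j
      rw [(hv (i j)).coe_eq_sum ((hβne j).biUnion fun t _ => hne t), Finset.sum_biUnion]
      exact fun t _ t' _ ht => CentralIP.pairwise_disjoint_of_before hne hα ht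
    have hu : ∀ t, (f t).elim 0 (fun i => ∑ r ∈ α t, (v i {r} : WithZero S)) =
        ∑ r ∈ α t, u (f t) r := by
      intro t
      cases f t <;> simp [u]
    rw [Finset.sum_congr rfl fun j _ => hv' j, hf, Finset.sum_congr rfl fun t _ => hu t,
      ← Finset.sum_add_distrib]
    exact h f F hF
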